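/- A graph of dimension $d$ is $G=(V,E,\lambda)$ with $V$ a finite set, $E\subseteq V\times V$ a loop-free edge relation and $\lambda:V\to\{0,1\}^d$; it is undirected if $E$ is symmetric. For a directed graph $G=(V,E,\lambda)$, its gadgetisation $\mathsf{gad}(G)$ is the undirected graph of dimension $3$ whose nodes are $v^1_u$ for $u\in V$ (labelled $(1,0,0)$) and $v^2_{(u,w)},v^3_{(u,w)}$ for $(u,w)\in E$ (labelled $(0,1,0)$ and $(0,0,1)$, respectively), and whose edges are $\{v^1_u,v^2_{(u,w)}\}$, $\{v^2_{(u,w)},v^3_{(u,w)}\}$, $\{v^3_{(u,w)},v^1_w\}$ for $(u,w)\in E$. Let $\varphi_{\mathit{GadLin}}(x)$ be the node classifier that accepts a node of a graph $G$ of dimension $3$ if and only if $G$ is isomorphic to $\mathsf{gad}(G')$ for some $G'=(V',E',\lambda')$ whose edge relation $E'$ is a strict linear order on $V'$. Let $\mathrm{C}^2$ be the two-variable fragment of first-order logic with equality, extended by the counting quantifiers $\exists_k x$ ("for at least $k$ elements $x$", $k\in\mathbb N$), over the signature with one binary predicate $E$ (edges) and unary predicates $P_1,\dots,P_d$, where $P_i$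 holds at $v$ iff $\lambda(v)_i=1$. Theorem. Over undirected graphs, $\varphi_{\mathit{GadLin}}$ is not expressible in $\mathrm{C}^2$: there is no $\mathrm{C}^2$ formula $\varphi(x)$ with exactly one free variable, over the signature $E,P_1,P_2,P_3$, such that for every undirected graph $G$ of dimension $3$ and every node $v$ of $G$, $G\models\varphi(v)$ if and only if $\varphi_{\mathit{GadLin}}$ accepts $v$ in $G$. -/

import Mathlib

/-- A finite, simple, directed graph of dimension `d` whose nodes are labelled by binary vectors
of length `d`. -/
structure LabelledGraph (d : ℕ) where
  /-- the nodes -/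
  V : Type
  finite_V : Finite V
  /-- the directed edges -/
  E : V → V → Prop
  loopless : ∀ v, ¬ E v v
  /-- the node labelling `λ : V → {0,1}^d` -/
  label : V → Fin d → Bool

namespace LabelledGraph

/-- Undirected graphs are identified with directed graphs whose edge relation is symmetric. -/
def IsUndirected {d : ℕ} (G : LabelledGraph d) : Prop :=
  ∀ u v, G.E u v → G.E v u

/-- The edge relation of `G` is a strict linear order on its nodes. -/
def IsStrictLinearOrder {d : ℕ} (G : LabelledGraph d) : Prop :=
  IsStrictTotalOrder G.V G.E

/-- Isomorphism of labelled graphs: a bijection on nodes that preserves and reflects edges and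
preserves labels. -/
def Isomorphic {d : ℕ} (G H : LabelledGraph d) : Prop :=
  ∃ f : G.V ≃ H.V,
    (∀ u v, G.E u v ↔ H.E (f u) (f v)) ∧ ∀ v, H.label (f v) = G.label v

/-- The nodes of the gadgetisation: `v¹_u` for every node `u` of `G`, and
`v²_(u,w)`, `v³_(u,w)` for every edge `(u,w)` of `G`. -/
inductive GadNode {d : ℕ} (G : LabelledGraph d) : Type
  | base (u : G.V) : GadNode G
  | second (u w : G.V) (h : G.E u w) : GadNode G
  | third (u w : G.V) (h : G.E u w) : GadNode G

/-- The edges of the gadgetisation, each taken in one direction: every edge `(u,w)` of `G` yields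
the path `v¹_u, v²_(u,w), v³_(u,w), v¹_w`. -/
inductive GadArc {d : ℕ} (G : LabelledGraph d) : GadNode G → GadNode G → Prop
  | first (u w : G.V) (h : G.E u w) : GadArc G (.base u) (.second u w h)
  | middle (u w : G.V) (h : G.E u w) : GadArc G (.second u w h) (.third u w h)
  | last (u w : G.V) (h : G.E u w) : GadArc G (.third u w h) (.base w)

theorem GadNode.finite {d : ℕ} (G : LabelledGraph d) : Finite (GadNode G) := by
  have := G.finite_V
  let f : GadNode G → G.V ⊕ (G.V × G.V) ⊕ (G.V × G.V) := fun a =>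
    match a with
    | .base u => .inl u
    | .second u w _ => .inr (.inl (u, w))
    | .third u w _ => .inr (.inr (u, w))
  refine Finite.of_injective f ?_
  intro a b hab
  cases a <;> cases b <;> simp_all [f]

theorem GadArc.irrefl {d : ℕ} (G : LabelledGraph d) (a : GadNode G) : ¬ GadArc G a a := by
  intro h
  cases h

/-- The gadgetisation `gad(G)` of a directed graph `G`, a graph of dimension 3. -/
def gad {d : ℕ} (G : LabelledGraph d) : LabelledGraph 3 where
  V := GadNode G
  finite_V := GadNode.finite G
  E a b := GadArc G a b ∨ GadArc G b a
  loopless a h := h.elim (GadArc.irrefl G a) (GadArc.irrefl G a)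
  label a :=
    match a with
    | .base _ => ![true, false, false]
    | .second _ _ _ => ![false, true, false]
    | .third _ _ _ => ![false, false, true]

end LabelledGraph

/-- Formulas of `C²` over the signature with `=`, the binary predicate `E`, and the unary
predicates `P_1, …, P_d`. The only variables are the two elements of `Fin 2`, and
`existsGE k i φ` is the counting quantifier "there are at least `k` values of the variable `i` such
that `φ`". The other connectives, `∃` (that is, `existsGE 1`) and `∀` are the usual
abbreviations. -/
inductive C2Formula (d : ℕ) : Type
  | eq (i j : Fin 2) : C2Formula d
  | edge (i j : Fin 2) : C2Formula d
  | pred (p : Fin d) (i : Fin 2) : C2Formula d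
  | neg (φ : C2Formula d) : C2Formula d
  | conj (φ ψ : C2Formula d) : C2Formula d
  | existsGE (k : ℕ) (i : Fin 2) (φ : C2Formula d) : C2Formula d

namespace C2Formula

/-- The free variables of a formula. -/
def freeVars {d : ℕ} : C2Formula d → Finset (Fin 2)
  | eq i j => {i, j}
  | edge i j => {i, j}
  | pred _ i => {i}
  | neg φ => φ.freeVars
  | conj φ ψ => φ.freeVars ∪ ψ.freeVars
  | existsGE _ i φ => φ.freeVars.erase i

/-- Satisfaction of a formula in (the structure of) a labelled graph, under an assignment `s` of
nodes to the two variables. -/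
def Realize {d : ℕ} (G : LabelledGraph d) : C2Formula d → (Fin 2 → G.V) → Prop
  | eq i j, s => s i = s j
  | edge i j, s => G.E (s i) (s j)
  | pred p i, s => G.label (s i) p = true
  | neg φ, s => ¬ φ.Realize G s
  | conj φ ψ, s => φ.Realize G s ∧ ψ.Realize G s
  | existsGE k i φ, s => (k : ℕ∞) ≤ {a : G.V | φ.Realize G (Function.update s i a)}.encard

/-- `φ` is a logical node classifier: exactly one variable is free in `φ`. -/
def IsClassifier {d : ℕ} (φ : C2Formula d) : Prop :=
  ∃ x : Fin 2, φ.freeVars = {x}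

/-- `G ⊨ φ(v)`, for a formula `φ` with one free variable: only the value of that variable matters,
so every variable is assigned `v`. -/
def Sat {d : ℕ} (φ : C2Formula d) (G : LabelledGraph d) (v : G.V) : Prop :=
  φ.Realize G (fun _ => v)

/-- Satisfaction depends only on the values of the free variables. -/
theorem realize_congr {d : ℕ} (G : LabelledGraph d) (φ : C2Formula d) :
    ∀ s t : Fin 2 → G.V, (∀ i ∈ φ.freeVars, s i = t i) → (φ.Realize G s ↔ φ.Realize G t) := by
  induction φ with
  | eq i j => intro s t h; simp_all [Realize, freeVars]
  | edge i j => intro s t h; simp_all [Realize, freeVars]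
  | pred p i => intro s t h; simp_all [Realize, freeVars]
  | neg φ ih => intro s t h; exact not_congr (ih s t h)
  | conj φ ψ ih1 ih2 =>
    intro s t h
    exact and_congr (ih1 s t fun i hi => h i (Finset.mem_union_left _ hi))
      (ih2 s t fun i hi => h i (Finset.mem_union_right _ hi))
  | existsGE k i φ ih =>
    intro s t h
    have key : ∀ a, φ.Realize G (Function.update s i a) ↔
        φ.Realize G (Function.update t i a) := by
      intro a
      apply ih
      intro j hj
      by_cases hji : j = i
      · subst hji; simp
      · simp [Function.update_of_ne hji, h j (Finset.mem_erase.2 ⟨hji, hj⟩)]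
    simp only [Realize, key]

end C2Formula

/-- A node classifier of dimension `d` assigns a truth value to every node of every graph of
dimension `d`. -/
def NodeClassifier (d : ℕ) : Type 1 :=
  (G : LabelledGraph d) → G.V → Prop

/-- Over undirected graphs, the node classifier `C` is expressible in `C²`. -/
def NodeClassifier.ExpressibleInC2OverUndirected {d : ℕ} (C : NodeClassifier d) : Prop :=
  ∃ φ : C2Formula d, φ.IsClassifier ∧
    ∀ G : LabelledGraph d, G.IsUndirected → ∀ v : G.V, φ.Sat G v ↔ C G v

/-- The classifier `φ_GadLin`: it accepts a node of `G` if and only if `G` is isomorphic to the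
gadgetisation of some strict linear order (of any dimension). -/
def gadLin : NodeClassifier 3 := fun G _ =>
  ∃ (d : ℕ) (L : LabelledGraph d), L.IsStrictLinearOrder ∧ G.Isomorphic L.gad

/-! Fix a formula of quantifier rank `q` with counts at most `K`. It cannot tell the gadgetisation
of a long linear order `R` on `2 * m + 2` points from that of `S`, which is `R` without the middle
pair `(m, m + 1)`. The second is no gadgetised linear order, since `m` and `m + 1` are incomparable.
In a gadgetisation, comparability of two base nodes is witnessed only by a path with two inner
nodes, and two variables cannot hold both ends while walking it.

The indistinguishability is a two-pebble counting game. With `r` rounds left, points at distance at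
least `r * (K + 2)` from both ends are confused with each other, all others are named exactly; a
gadget node is described by its kind and the classes of the two points it is attached to. Each round
enlarges the confused set. A description that involves a confused point is realised either at least
`K` times, beyond what the formula can count, or in numbers that can be matched exactly. The missing
pair lies inside the confused set throughout.

`Answerable` isolates what one round needs of `R`, `S` and the two confused sets,
`Answerable.answered` plays the round, and `realize_iff_of_pebbled` is the induction on formulas. -/

/-! ### Thresholded counting through fibres -/

/-- If every fibre of `f` is no larger than the corresponding fibre of `g`, up to the threshold
`K`, then the same holds for unions of corresponding fibres. -/
theorem Set.natCast_le_encard_of_fibers {α β κ : Type*} [Finite α] (f : α → κ) (g : β → κ)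
    (K : ℕ)
    (hfib : ∀ a₀, {a | f a = f a₀}.encard ≤ {b | g b = f a₀}.encard ∨
      (K : ℕ∞) ≤ {b | g b = f a₀}.encard)
    {A : Set α} {B : Set β} (hAB : ∀ a b, f a = g b → a ∈ A → b ∈ B) {k : ℕ} (hk : k ≤ K)
    (hA : (k : ℕ∞) ≤ A.encard) : (k : ℕ∞) ≤ B.encard := by
  -- A single fibre of size at least `K` over a value taken on `A` lies inside `B` and already
  -- suffices. Otherwise every fibre met by `A` injects into its counterpart, and these injections
  -- glue because their targets are disjoint fibres.
  by_cases hlarge : ∃ a₀ ∈ A, (K : ℕ∞) ≤ {b | g b = f a₀}.encard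
  · obtain ⟨a₀, ha₀, hK⟩ := hlarge
    refine (Nat.cast_le.2 hk).trans (hK.trans (Set.encard_le_encard ?_))
    intro b hb
    exact hAB a₀ b hb.symm ha₀
  · push Not at hlarge
    rcases A.eq_empty_or_nonempty with rfl | ⟨a₁, ha₁⟩
    · simp at hA
      simp [hA]
    have hle : ∀ a₀ ∈ A, {a | f a = f a₀}.encard ≤ {b | g b = f a₀}.encard :=
      fun a₀ ha₀ => (hfib a₀).resolve_right (not_le.2 (hlarge a₀ ha₀))
    have hne : Nonempty β := by
      have hpos : 0 < {a | f a = f a₁}.encard := Set.encard_pos.2 ⟨a₁, rfl⟩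
      obtain ⟨b₀, -⟩ := Set.encard_pos.1 (hpos.trans_le (hle a₁ ha₁))
      exact ⟨b₀⟩
    have hinj : ∀ c : κ, ∃ e : α → β, (∃ a₀ ∈ A, f a₀ = c) →
        (∀ a, f a = c → g (e a) = c) ∧ Set.InjOn e {a | f a = c} := by
      intro c
      by_cases hc : ∃ a₀ ∈ A, f a₀ = c
      · obtain ⟨a₀, ha₀, rfl⟩ := hc
        obtain ⟨e, he, hi⟩ :=
          (Set.toFinite {a | f a = f a₀}).exists_injOn_of_encard_le (hle a₀ ha₀)
        exact ⟨e, fun _ => ⟨fun a ha => he ha, hi⟩⟩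
      · exact ⟨fun _ => hne.some, fun h => absurd h hc⟩
    choose e he using hinj
    refine hA.trans (Set.encard_le_encard_of_injOn (f := fun a => e (f a) a) ?_ ?_)
    · intro a ha
      exact hAB a _ ((he (f a) ⟨a, ha, rfl⟩).1 a rfl).symm ha
    · intro a ha a' ha' h
      have h1 := (he (f a) ⟨a, ha, rfl⟩).1 a rfl
      have h2 := (he (f a') ⟨a', ha', rfl⟩).1 a' rfl
      have h' : e (f a) a = e (f a') a' := h
      have hf : f a = f a' := by rw [← h1, ← h2, h']
      rw [← hf] at h'
      exact (he (f a) ⟨a, ha, rfl⟩).2 rfl hf.symm h'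

/-- A set has at least `K` elements if a map sends it onto a set with at least `K` elements. -/
theorem Set.le_encard_of_forall_exists {α β : Type*} (π : α → β) {A : Set α} {B : Set β} {K : ℕ∞}
    (hB : K ≤ B.encard) (h : ∀ b ∈ B, ∃ a ∈ A, π a = b) : K ≤ A.encard :=
  hB.trans ((Set.encard_le_encard fun b hb => h b hb).trans (Set.encard_image_le π A))

namespace LabelledGraph

/-- The unlabelled graph with a given irreflexive edge relation. -/

abbrev ofRel {V : Type} [hV : Finite V] (R : V → V → Prop) (hR : ∀ v, ¬ R v v) :
    LabelledGraph 0 where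
  V := V
  finite_V := hV
  E := R
  loopless := hR
  label _ := Fin.elim0

theorem gad_isUndirected {d : ℕ} (G : LabelledGraph d) : G.gad.IsUndirected :=
  fun _ _ h => h.symm

/-! ### Nodes of a gadgetisation, seen from either end of an edge -/

/-- `R` if `b` is false, and the converse of `R` if `b` is true. -/
def orient {V : Type} (R : V → V → Prop) (b : Bool) (p q : V) : Prop :=
  if b then R q p else R p q

namespace GadNode

variable {d : ℕ} {G : LabelledGraph d}

/-- The node next to `base p` on the path of an edge between `p` and `q`; this edge leaves `p`
if `b` is false and enters `p` if `b` is true. -/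
def arc : (b : Bool) → (p q : G.V) → orient G.E b p q → GadNode G
  | false, p, q, h => second p q h
  | true, p, q, h => third q p h

/-- Which of the three kinds of nodes a node belongs to. -/
def kind : GadNode G → Option Bool
  | base _ => none
  | second _ _ _ => some false
  | third _ _ _ => some true

/-- The node of `G` that a node of the gadgetisation is, or is adjacent to. -/
def near : GadNode G → G.V
  | base u => u
  | second u _ _ => u
  | third _ w _ => w

/-- The other end of the edge of `G` that a node of the gadgetisation belongs to. -/
def far : GadNode G → G.V
  | base u => u
  | second _ w _ => w
  | third u _ _ => u

@[simp] theorem kind_base (u : G.V) : (base u : GadNode G).kind = none := rfl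
@[simp] theorem near_base (u : G.V) : (base u : GadNode G).near = u := rfl

@[simp] theorem kind_arc (b : Bool) (p q : G.V) (h : orient G.E b p q) :
    (arc b p q h).kind = some b := by cases b <;> rfl
@[simp] theorem near_arc (b : Bool) (p q : G.V) (h : orient G.E b p q) :
    (arc b p q h).near = p := by cases b <;> rfl
@[simp] theorem far_arc (b : Bool) (p q : G.V) (h : orient G.E b p q) :
    (arc b p q h).far = q := by cases b <;> rfl

theorem eq_base_or_arc (a : GadNode G) :
    (∃ u, a = base u) ∨ ∃ b p q h, a = arc b p q h := by
  cases a with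
  | base u => exact .inl ⟨u, rfl⟩
  | second u w h => exact .inr ⟨false, u, w, h, rfl⟩
  | third u w h => exact .inr ⟨true, w, u, h, rfl⟩

@[simp] theorem arc_inj {b b' : Bool} {p q p' q' : G.V} {h : orient G.E b p q}
    {h' : orient G.E b' p' q'} : arc b p q h = arc b' p' q' h' ↔ b = b' ∧ p = p' ∧ q = q' := by
  constructor
  · intro e
    exact ⟨by simpa using congrArg kind e, by simpa using congrArg near e,
      by simpa using congrArg far e⟩
  · rintro ⟨rfl, rfl, rfl⟩
    rfl

@[simp] theorem base_ne_arc {b : Bool} {u p q : G.V} {h : orient G.E b p q} :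
    base u ≠ arc b p q h := fun e => by simpa using congrArg kind e

@[simp] theorem arc_ne_base {b : Bool} {u p q : G.V} {h : orient G.E b p q} :
    arc b p q h ≠ base u := base_ne_arc.symm

/-- Adjacency in the gadgetisation. -/
def Adj (a b : GadNode G) : Prop := GadArc G a b ∨ GadArc G b a

theorem Adj.symm {a b : GadNode G} (h : a.Adj b) : b.Adj a := Or.symm h

@[simp] theorem not_adj_base_base (u w : G.V) : ¬ (base u : GadNode G).Adj (base w) := by
  rintro (h | h) <;> cases h

@[simp] theorem adj_base_arc {b : Bool} {u p q : G.V} {h : orient G.E b p q} :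
    (base u).Adj (arc b p q h) ↔ u = p := by
  constructor
  · cases b
    · rintro (h | h) <;> cases h; rfl
    · rintro (h | h) <;> cases h; rfl
  · rintro rfl
    cases b
    · exact .inl (.first _ _ _)
    · exact .inr (.last _ _ _)

@[simp] theorem adj_arc_base {b : Bool} {u p q : G.V} {h : orient G.E b p q} :
    (arc b p q h).Adj (base u) ↔ u = p :=
  ⟨fun h => adj_base_arc.1 h.symm, fun h => (adj_base_arc.2 h).symm⟩

theorem orient_not {V : Type} {R : V → V → Prop} {b : Bool} {p q : V} :
    orient R (!b) q p ↔ orient R b p q := by cases b <;> simp [orient]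

@[simp] theorem adj_arc_arc {b b' : Bool} {p q p' q' : G.V} {h : orient G.E b p q}
    {h' : orient G.E b' p' q'} :
    (arc b p q h).Adj (arc b' p' q' h') ↔ b' = !b ∧ p' = q ∧ q' = p := by
  constructor
  · cases b <;> cases b'
    · rintro (h | h) <;> cases h
    · rintro (h | h) <;> cases h; simp
    · rintro (h | h) <;> cases h; simp
    · rintro (h | h) <;> cases h
  · rintro ⟨rfl, rfl, rfl⟩
    cases b
    · exact .inl (.middle _ _ _)
    · exact .inr (.middle _ _ _)

end GadNode

end LabelledGraph

/-! ### Types of gadget nodes and one round of the game -/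

namespace LabelledGraph

open GadNode

open Classical in
/-- The node `p` itself, unless it lies in the set `mid` of nodes that are not told apart. -/
noncomputable def cls {V : Type} (mid : V → Prop) (p : V) : Option V :=
  if mid p then none else some p

theorem cls_of_mid {V : Type} {mid : V → Prop} {p : V} (h : mid p) : cls mid p = none := by
  simp [cls, h]

theorem eq_of_cls_eq {V : Type} {mid : V → Prop} {p q : V} (hp : ¬ mid p)
    (h : cls mid q = cls mid p) : q = p := by
  by_cases hq : mid q
  · simp [cls, hp, hq] at h
  · simpa [cls, hp, hq] using h

theorem mid_of_cls_eq {V : Type} {mid : V → Prop} {p q : V} (h : cls mid q = cls mid p) :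
    mid q ↔ mid p := by
  by_cases hq : mid q <;> by_cases hp : mid p <;> simp [cls, hp, hq] at h ⊢

/-- A larger confused set gives coarser classes. Hence a pebble left in place still matches its
counterpart after the round. -/
theorem cls_eq_of_imp {V : Type} {mid mid' : V → Prop} (hm : ∀ p, mid' p → mid p) {p q : V}
    (h : cls mid' p = cls mid' q) : cls mid p = cls mid q := by
  by_cases hq : mid' q
  · rw [cls_of_mid (hm _ hq), cls_of_mid (hm _ ((mid_of_cls_eq h).2 hq))]
  · rw [eq_of_cls_eq hq h]

/-- How an answer `(p, q)` avoids the forbidden pair `(i', j')`: a confused coordinate can be moved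
off it, and if neither is confused, the classes determine both points, so `(u, w)` would itself be
the pair `(i, j)`. -/
theorem not_eq_pair_of_cls {V : Type} {mid : V → Prop} {u w i j p q i' j' : V}
    (hne : ¬ (u = i ∧ w = j)) (hi : cls mid i' = cls mid i)
    (hj : cls mid j' = cls mid j) (hp : cls mid p = cls mid u)
    (hq : cls mid q = cls mid w) (hpi : mid u → p ≠ i') (hqj : ¬ mid u → mid w → q ≠ j') :
    ¬ (p = i' ∧ q = j') := by
  rintro ⟨rfl, rfl⟩
  by_cases hu : mid u
  · exact hpi hu rfl
  by_cases hw : mid w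
  · exact hqj hu hw rfl
  exact hne ⟨(eq_of_cls_eq hu (hi.symm.trans hp)).symm, (eq_of_cls_eq hw (hj.symm.trans hq)).symm⟩

/-- The type of a node of the gadgetisation: its kind and the classes of the two nodes it is
attached to. -/
noncomputable def GadNode.type {d : ℕ} {G : LabelledGraph d} (mid : G.V → Prop)
    (a : GadNode G) : Option Bool × Option G.V × Option G.V :=
  (a.kind, cls mid a.near, cls mid a.far)

/-- The type of a node together with its position relative to the node `x`. -/
noncomputable def GadNode.typeOver {d : ℕ} {G : LabelledGraph d} (mid : G.V → Prop)
    (x a : GadNode G) : (Option Bool × Option G.V × Option G.V) × Prop × Prop :=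
  (a.type mid, a = x, x.Adj a)

/-- Conditions under which pebbles on nodes of the same type with respect to `mid'` in the
gadgetisations of `R` and `S` can be answered, up to the threshold `K`, by nodes of the same type
with respect to `mid`. -/
structure Answerable {V : Type} (K : ℕ) (R S : V → V → Prop) (mid mid' : V → Prop) : Prop where
  mid_of_mid' : ∀ p, mid' p → mid p
  exists_mid'_ne : ∀ p₀, ∃ p, mid' p ∧ p ≠ p₀
  many_mid_ne : ∀ p₀, (K : ℕ∞) ≤ {q | mid q ∧ q ≠ p₀}.encard
  many_mid_orient : ∀ b p, mid' p → (K : ℕ∞) ≤ {q | mid q ∧ orient S b p q}.encard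
  orient_of_not_mid' : ∀ b u w, ¬ mid' u → orient R b u w → orient S b u w
  orient_of_mid : ∀ b i i' w, mid i → mid i' → ¬ mid w → orient R b i w → orient S b i' w

section Step

variable {V : Type} [Finite V] {K : ℕ} {R S : V → V → Prop} {mid mid' : V → Prop}
  {hR : ∀ v, ¬ R v v} {hS : ∀ v, ¬ S v v}

/-- Up to the threshold `K`, at least as many nodes `b` look from `y` as the node `a₀` does
from `x`, as there are nodes `a` that look from `x` as `a₀` does. -/
def GadNode.Answered (K : ℕ) (mid : V → Prop) (x : GadNode (ofRel R hR))
    (y : GadNode (ofRel S hS)) (a₀ : GadNode (ofRel R hR)) : Prop :=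
  {a | GadNode.typeOver mid x a = GadNode.typeOver mid x a₀}.encard ≤
      {b | GadNode.typeOver mid y b = GadNode.typeOver (G := ofRel R hR) mid x a₀}.encard ∨
    (K : ℕ∞) ≤ {b | GadNode.typeOver mid y b = GadNode.typeOver (G := ofRel R hR) mid x a₀}.encard

variable {x a₀ : GadNode (ofRel R hR)} {y : GadNode (ofRel S hS)}

theorem typeOver_eq_of_apart {b : GadNode (ofRel S hS)} (h : a₀ ≠ x) (hadj : ¬ x.Adj a₀)
    (h' : b ≠ y) (hadj' : ¬ y.Adj b)
    (ht : GadNode.type mid b = GadNode.type (G := ofRel R hR) mid a₀) :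
    GadNode.typeOver mid y b = GadNode.typeOver (G := ofRel R hR) mid x a₀ := by
  simp only [GadNode.typeOver, ht, Prod.mk.injEq, eq_iff_iff, true_and]
  tauto

theorem answered_of_unique (b : GadNode (ofRel S hS))
    (hb : GadNode.typeOver mid y b = GadNode.typeOver (G := ofRel R hR) mid x a₀)
    (huniq : ∀ a : GadNode (ofRel R hR),
      GadNode.typeOver mid x a = GadNode.typeOver mid x a₀ → a = a₀) :
    GadNode.Answered K mid x y a₀ := by
  left
  have h1 : {a | GadNode.typeOver mid x a = GadNode.typeOver mid x a₀} ⊆ {a₀} := huniq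
  refine (Set.encard_le_encard h1).trans ?_
  rw [Set.encard_singleton, Set.one_le_encard_iff_nonempty]
  exact ⟨b, hb⟩

/-- Answers are told apart by the point `π` reads off, so it is enough to let that point range over
`K` values. -/
theorem answered_of_many (π : GadNode (ofRel S hS) → V) {Q : Set V} (hQ : (K : ℕ∞) ≤ Q.encard)
    (h : ∀ q ∈ Q, ∃ b : GadNode (ofRel S hS), π b = q ∧
      GadNode.typeOver mid y b = GadNode.typeOver (G := ofRel R hR) mid x a₀) :
    GadNode.Answered K mid x y a₀ := by
  right
  refine Set.le_encard_of_forall_exists π hQ fun q hq => ?_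
  obtain ⟨b, hb, hb'⟩ := h q hq
  exact ⟨b, hb', hb⟩

theorem typeOver_eq_components {a : GadNode (ofRel R hR)}
    (h : GadNode.typeOver mid x a = GadNode.typeOver mid x a₀) :
    a.kind = a₀.kind ∧ cls mid a.near = cls mid a₀.near ∧ cls mid a.far = cls mid a₀.far ∧
      (a = x ↔ a₀ = x) ∧ (x.Adj a ↔ x.Adj a₀) := by
  simpa [GadNode.typeOver, GadNode.type, and_assoc] using h

theorem arc_type {R' : V → V → Prop} {hR' : ∀ v, ¬ R' v v} (b : Bool) (p q : V)
    (h : orient R' b p q) :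
    GadNode.type mid (GadNode.arc b p q h : GadNode (ofRel R' hR')) =
      (some b, cls mid p, cls mid q) := by
  simp only [GadNode.type, kind_arc, near_arc, far_arc]

theorem base_type {R' : V → V → Prop} {hR' : ∀ v, ¬ R' v v} (u : V) :
    GadNode.type mid (GadNode.base u : GadNode (ofRel R' hR')) =
      (none, cls mid u, cls mid u) := rfl

theorem eq_of_kind_near_far {a a' : GadNode (ofRel R hR)} (hk : a.kind = a'.kind)
    (hn : a.near = a'.near) (hf : a.far = a'.far) : a = a' := by
  rcases a.eq_base_or_arc with ⟨u, rfl⟩ | ⟨b, p, q, h, rfl⟩ <;>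
  rcases a'.eq_base_or_arc with ⟨u', rfl⟩ | ⟨b', p', q', h', rfl⟩ <;> simp_all

/-- Nodes of kind `base` that are neither `x` nor adjacent to `x`. -/
theorem Answerable.answered_base (H : Answerable K R S mid mid') {u : V}
    (hx : GadNode.base u ≠ x) (hadj : ¬ x.Adj (.base u)) (p₀ : V)
    (hgood : ∀ w : V, cls mid w = cls mid u → (mid u → w ≠ p₀) →
      (GadNode.base w : GadNode (ofRel S hS)) ≠ y ∧ ¬ y.Adj (.base w)) :
    GadNode.Answered K mid x y (GadNode.base u : GadNode (ofRel R hR)) := by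
  by_cases hu : mid u
  · refine answered_of_many near (H.many_mid_ne p₀) ?_
    rintro q ⟨hq, hqp⟩
    have hc : cls mid q = cls mid u := by rw [cls_of_mid hq, cls_of_mid hu]
    obtain ⟨h1, h2⟩ := hgood q hc fun _ => hqp
    exact ⟨.base q, rfl, typeOver_eq_of_apart hx hadj h1 h2 (by rw [base_type, base_type, hc])⟩
  · obtain ⟨h1, h2⟩ := hgood u rfl fun h => absurd h hu
    refine answered_of_unique (.base u) (typeOver_eq_of_apart hx hadj h1 h2 rfl) ?_
    intro a ha
    obtain ⟨hk, hn, hf, -⟩ := typeOver_eq_components ha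
    exact eq_of_kind_near_far hk (eq_of_cls_eq hu hn) (eq_of_cls_eq hu hf)

/-- Nodes of kind `arc` that are neither `x` nor adjacent to `x`. -/
theorem Answerable.answered_arc (H : Answerable K R S mid mid') {b : Bool} {u w : V}
    {h : orient R b u w}
    (hx : GadNode.arc b u w h ≠ x) (hadj : ¬ x.Adj (.arc b u w h)) (p₀ q₀ : V)
    (hgood : ∀ (p q : V) (h' : orient S b p q), cls mid p = cls mid u → cls mid q = cls mid w →
      (mid u → p ≠ p₀) → (¬ mid u → mid w → q ≠ q₀) →
      (GadNode.arc b p q h' : GadNode (ofRel S hS)) ≠ y ∧ ¬ y.Adj (.arc b p q h')) :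
    GadNode.Answered K mid x y (GadNode.arc b u w h : GadNode (ofRel R hR)) := by
  have hans : ∀ (p q : V) (h' : orient S b p q), cls mid p = cls mid u →
      cls mid q = cls mid w → (mid u → p ≠ p₀) → (¬ mid u → mid w → q ≠ q₀) →
      GadNode.typeOver mid y (GadNode.arc b p q h' : GadNode (ofRel S hS)) =
        GadNode.typeOver mid x (GadNode.arc b u w h : GadNode (ofRel R hR)) := by
    intro p q h' hp hq hp₀ hq₀
    obtain ⟨h1, h2⟩ := hgood p q h' hp hq hp₀ hq₀
    exact typeOver_eq_of_apart hx hadj h1 h2 (by rw [arc_type, arc_type, hp, hq])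
  by_cases hu : mid u <;> by_cases hw : mid w
  -- The near end is taken in the smaller set `mid'`: only there are `K` confused points guaranteed
  -- on either side.
  · obtain ⟨p, hp, hpp⟩ := H.exists_mid'_ne p₀
    refine answered_of_many far (H.many_mid_orient b p hp) ?_
    rintro q ⟨hq, hpq⟩
    exact ⟨.arc b p q hpq, far_arc .., hans p q hpq
      (by rw [cls_of_mid hu, cls_of_mid (H.mid_of_mid' p hp)])
      (by rw [cls_of_mid hw, cls_of_mid hq]) (fun _ => hpp) (absurd hu)⟩
  · refine answered_of_many near (H.many_mid_ne p₀) ?_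
    rintro p ⟨hp, hpp⟩
    exact ⟨.arc b p w (H.orient_of_mid b u p w hu hp hw h), near_arc .., hans p w _
      (by rw [cls_of_mid hu, cls_of_mid hp]) rfl (fun _ => hpp) (absurd hu)⟩
  · refine answered_of_many far (H.many_mid_ne q₀) ?_
    rintro q ⟨hq, hqq⟩
    exact ⟨.arc b u q (orient_not.1 (H.orient_of_mid (!b) w q u hw hq hu (orient_not.2 h))),
      far_arc .., hans u q _ rfl (by rw [cls_of_mid hw, cls_of_mid hq]) (fun h => absurd h hu)
      (fun _ _ => hqq)⟩
  · refine answered_of_unique (.arc b u w (H.orient_of_not_mid' b u w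
      (fun h' => hu (H.mid_of_mid' u h')) h)) (hans u w _ rfl rfl (fun h => absurd h hu)
      (fun _ h => absurd h hw)) ?_
    intro a ha
    obtain ⟨hk, hn, hf, -⟩ := typeOver_eq_components ha
    rw [near_arc] at hn
    rw [far_arc] at hf
    refine eq_of_kind_near_far hk ?_ ?_
    · rw [near_arc]
      exact eq_of_cls_eq hu hn
    · rw [far_arc]
      exact eq_of_cls_eq hw hf

/-- Nodes adjacent to a node of kind `base`. -/
theorem Answerable.answered_adj_base (H : Answerable K R S mid mid') {b : Bool} {i i' w : V}
    {h : orient R b i w} (hi : cls mid' i = cls mid' i') :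
    GadNode.Answered K mid (GadNode.base i : GadNode (ofRel R hR))
      (GadNode.base i' : GadNode (ofRel S hS)) (GadNode.arc b i w h) := by
  have hans : ∀ (q : V) (h' : orient S b i' q), cls mid q = cls mid w →
      GadNode.typeOver mid (GadNode.base i') (GadNode.arc b i' q h' : GadNode (ofRel S hS)) =
        GadNode.typeOver mid (GadNode.base i) (GadNode.arc b i w h : GadNode (ofRel R hR)) := by
    intro q h' hq
    simp only [GadNode.typeOver, arc_type, arc_ne_base, adj_base_arc, hq,
      cls_eq_of_imp H.mid_of_mid' hi]
  have hshape : ∀ a : GadNode (ofRel R hR),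
      GadNode.typeOver mid (GadNode.base i) a =
        GadNode.typeOver mid (GadNode.base i) (GadNode.arc b i w h : GadNode (ofRel R hR)) →
      ∃ (q : V) (h' : orient R b i q), a = .arc b i q h' ∧ cls mid q = cls mid w := by
    intro a ha
    obtain ⟨hk, hn, hf, -, hadj⟩ := typeOver_eq_components ha
    rcases a.eq_base_or_arc with ⟨u, rfl⟩ | ⟨b', p, q, h', rfl⟩
    · simp at hk
    · simp only [kind_arc, far_arc, adj_base_arc, iff_true, Option.some.injEq] at hk hf hadj
      subst hk hadj
      exact ⟨q, h', rfl, hf⟩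
  by_cases hm : mid' i
  · have hm' : mid' i' := (mid_of_cls_eq hi).1 hm
    by_cases hw : mid w
    · refine answered_of_many far (H.many_mid_orient b i' hm') ?_
      rintro q ⟨hq, hiq⟩
      exact ⟨.arc b i' q hiq, far_arc .., hans q hiq (by rw [cls_of_mid hw, cls_of_mid hq])⟩
    · refine answered_of_unique (.arc b i' w (H.orient_of_mid b i i' w (H.mid_of_mid' _ hm)
        (H.mid_of_mid' _ hm') hw h)) (hans w _ rfl) ?_
      intro a ha
      obtain ⟨q, h', rfl, hq⟩ := hshape a ha
      exact arc_inj.2 ⟨rfl, rfl, eq_of_cls_eq hw hq⟩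
  -- Here `i` may lie in `mid` but close to its boundary, with fewer than `K` confused points on one
  -- side. The count is then matched exactly: every edge of `R` at `i` is also an edge of `S`.
  · obtain rfl : i' = i := eq_of_cls_eq hm hi.symm
    left
    have hinj : Set.InjOn far {a : GadNode (ofRel R hR) |
        GadNode.typeOver mid (GadNode.base i') a = GadNode.typeOver mid (GadNode.base i')
          (GadNode.arc b i' w h : GadNode (ofRel R hR))} := by
      intro a ha a' ha' haa
      obtain ⟨q, h', rfl, -⟩ := hshape a ha
      obtain ⟨q', h'', rfl, -⟩ := hshape a' ha'
      rw [far_arc, far_arc] at haa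
      exact arc_inj.2 ⟨rfl, rfl, haa⟩
    rw [← hinj.encard_image]
    refine Set.le_encard_of_forall_exists (far : GadNode (ofRel S hS) → V) le_rfl ?_
    rintro q ⟨a, ha, rfl⟩
    obtain ⟨q, h', rfl, hq⟩ := hshape a ha
    exact ⟨.arc b i' q (H.orient_of_not_mid' b i' q hm h'), hans q _ hq, by simp⟩

/-- Nodes of the same type with respect to `mid'` see, up to the threshold `K`, the same numbers
of nodes of each type with respect to `mid`. -/
theorem Answerable.answered (H : Answerable K R S mid mid')
    (hxy : GadNode.type mid' y = GadNode.type (G := ofRel R hR) mid' x)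
    (a₀ : GadNode (ofRel R hR)) : GadNode.Answered K mid x y a₀ := by
  simp only [GadNode.type, Prod.mk.injEq] at hxy
  obtain ⟨hk, hn, hf⟩ := hxy
  have hn' := cls_eq_of_imp H.mid_of_mid' hn
  have hf' := cls_eq_of_imp H.mid_of_mid' hf
  by_cases hax : a₀ = x
  · subst hax
    refine answered_of_unique y ?_ fun a ha => ?_
    · have h1 : ¬ y.Adj y := (gad (ofRel S hS)).loopless y
      have h2 : ¬ a₀.Adj a₀ := (gad (ofRel R hR)).loopless a₀
      simp only [GadNode.typeOver, GadNode.type, hk, hn', hf', h1, h2]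
    · exact (typeOver_eq_components ha).2.2.2.1.2 rfl
  by_cases hadj : x.Adj a₀
  · rcases x.eq_base_or_arc with ⟨i, rfl⟩ | ⟨b, i, j, hij, rfl⟩ <;>
    rcases y.eq_base_or_arc with ⟨i', rfl⟩ | ⟨b', i', j', hij', rfl⟩
    · rcases a₀.eq_base_or_arc with ⟨u, rfl⟩ | ⟨d, u, w, huw, rfl⟩
      · simp at hadj
      · obtain rfl := adj_base_arc.1 hadj
        exact H.answered_adj_base hn.symm
    · simp at hk
    · simp at hk
    · simp only [kind_arc, Option.some.injEq, near_arc, far_arc] at hk hn hf hn' hf'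
      subst hk
      -- An inner path node has two neighbours, of different kinds, so its kind determines the
      -- neighbour.
      have huniq : ∀ a : GadNode (ofRel R hR), GadNode.typeOver mid (GadNode.arc b' i j hij) a =
          GadNode.typeOver mid (GadNode.arc b' i j hij) a₀ → a = a₀ := by
        intro a ha
        obtain ⟨hka, -, -, -, hiff⟩ := typeOver_eq_components ha
        have hadja := hiff.2 hadj
        clear hiff
        rcases a₀.eq_base_or_arc with ⟨u, rfl⟩ | ⟨d, u, w, huw, rfl⟩ <;>
        rcases a.eq_base_or_arc with ⟨u', rfl⟩ | ⟨d', u', w', huw', rfl⟩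
        · rw [adj_arc_base] at hadj hadja
          rw [hadj, hadja]
        · simp at hka
        · simp at hka
        · rw [adj_arc_arc] at hadj hadja
          exact arc_inj.2 ⟨hadja.1.trans hadj.1.symm, hadja.2.1.trans hadj.2.1.symm,
            hadja.2.2.trans hadj.2.2.symm⟩
      rcases a₀.eq_base_or_arc with ⟨u, rfl⟩ | ⟨d, u, w, huw, rfl⟩
      · obtain rfl := adj_arc_base.1 hadj
        refine answered_of_unique (.base i') ?_ huniq
        simp only [GadNode.typeOver, base_type, base_ne_arc, adj_arc_base, hn']
      · obtain ⟨rfl, rfl, rfl⟩ := adj_arc_arc.1 hadj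
        refine answered_of_unique (.arc (!b') j' i' (orient_not.2 hij')) ?_ huniq
        simp [GadNode.typeOver, arc_type, adj_arc_arc, hn', hf']
  · rcases a₀.eq_base_or_arc with ⟨u, rfl⟩ | ⟨d, u, w, huw, rfl⟩
    · refine H.answered_base hax hadj y.near fun w hw hwy => ?_
      have hne : w ≠ y.near := by
        intro hwn
        by_cases hu : mid u
        · exact hwy hu hwn
        -- An exactly named `u` with `w` near `y` would also be the point near `x`, making `a₀`
        -- equal or adjacent to `x`.
        have hxu : x.near = u := eq_of_cls_eq hu (by rw [← hn', ← hwn, hw])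
        rcases x.eq_base_or_arc with ⟨i, rfl⟩ | ⟨b, i, j, hij, rfl⟩
        · exact hax (congrArg GadNode.base hxu.symm)
        · exact hadj (adj_arc_base.2 (by rw [← hxu, near_arc]))
      refine ⟨fun h => hne (by rw [← h, near_base]), fun h => hne ?_⟩
      rcases y.eq_base_or_arc with ⟨i', rfl⟩ | ⟨b', i', j', hij', rfl⟩
      · exact absurd h (not_adj_base_base _ _)
      · rw [near_arc]
        exact adj_arc_base.1 h
    · rcases x.eq_base_or_arc with ⟨i, rfl⟩ | ⟨b, i, j, hij, rfl⟩ <;>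
      rcases y.eq_base_or_arc with ⟨i', rfl⟩ | ⟨b', i', j', hij', rfl⟩
      · refine H.answered_arc hax hadj i' i' fun p q h' hp hq hp₀ _ =>
          ⟨arc_ne_base, fun h => ?_⟩
        obtain rfl := adj_base_arc.1 h
        by_cases hu : mid u
        · exact hp₀ hu rfl
        · exact hadj (adj_base_arc.2 (eq_of_cls_eq hu (hn'.symm.trans hp)))
      · simp at hk
      · simp at hk
      · simp only [kind_arc, Option.some.injEq, near_arc, far_arc] at hk hn' hf'
        subst hk
        -- With equal kinds the answer could only coincide with `y`, so `(i', j')` is avoided; with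
        -- opposite kinds it could only be adjacent to `y`, so the reversed pair is.
        by_cases hd : d = b'
        · subst hd
          refine H.answered_arc hax hadj i' j' fun p q h' hp hq hp₀ hq₀ =>
            ⟨fun h => ?_, fun h => ?_⟩
          · exact not_eq_pair_of_cls (fun h => hax (arc_inj.2 ⟨rfl, h⟩)) hn' hf' hp hq hp₀ hq₀
              (arc_inj.1 h).2
          · simpa using (adj_arc_arc.1 h).1
        · refine H.answered_arc hax hadj j' i' fun p q h' hp hq hp₀ hq₀ =>
            ⟨fun h => hd (arc_inj.1 h).1, fun h => ?_⟩
          exact not_eq_pair_of_cls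
            (fun h => hadj (adj_arc_arc.2 ⟨by simpa using Bool.eq_not_of_ne hd, h⟩))
            hf' hn' hp hq hp₀ hq₀ (adj_arc_arc.1 h).2

end Step

end LabelledGraph

/-! ### From one round to formulas of bounded rank and counts -/

namespace C2Formula

/-- The quantifier rank of a formula. -/
def rank {d : ℕ} : C2Formula d → ℕ
  | eq _ _ => 0
  | edge _ _ => 0
  | pred _ _ => 0
  | neg φ => φ.rank
  | conj φ ψ => max φ.rank ψ.rank
  | existsGE _ _ φ => φ.rank + 1

/-- The largest number that occurs in a counting quantifier of a formula. -/
def countBound {d : ℕ} : C2Formula d → ℕ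
  | eq _ _ => 0
  | edge _ _ => 0
  | pred _ _ => 0
  | neg φ => φ.countBound
  | conj φ ψ => max φ.countBound ψ.countBound
  | existsGE k _ φ => max k φ.countBound

end C2Formula

namespace LabelledGraph

open GadNode

theorem gad_label_eq_of_kind_eq {d d' : ℕ} {G : LabelledGraph d} {H : LabelledGraph d'}
    {a : GadNode G} {b : GadNode H} (h : a.kind = b.kind) : G.gad.label a = H.gad.label b := by
  cases a <;> cases b <;> simp [GadNode.kind] at h <;> rfl

section Pebbles

variable {V : Type} [Finite V] {K : ℕ} {R S : V → V → Prop} {mid mid' : V → Prop}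
  {hR : ∀ v, ¬ R v v} {hS : ∀ v, ¬ S v v}

/-- Two assignments to the two variables are equivalent with respect to `mid` if corresponding
nodes have the same type and are in the same relative position. -/
structure Pebbled (mid : V → Prop) (s : Fin 2 → GadNode (ofRel R hR))
    (t : Fin 2 → GadNode (ofRel S hS)) : Prop where
  type_eq : ∀ i, GadNode.type (G := ofRel R hR) mid (s i) = GadNode.type mid (t i)
  eq_iff : ∀ i j, s i = s j ↔ t i = t j
  adj_iff : ∀ i j, (s i).Adj (s j) ↔ (t i).Adj (t j)

variable {s : Fin 2 → GadNode (ofRel R hR)} {t : Fin 2 → GadNode (ofRel S hS)}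

theorem Pebbled.symm (h : Pebbled mid s t) : Pebbled mid t s :=
  ⟨fun i => (h.type_eq i).symm, fun i j => (h.eq_iff i j).symm, fun i j => (h.adj_iff i j).symm⟩

theorem type_eq_of_imp (hm : ∀ p, mid' p → mid p) {x : GadNode (ofRel R hR)}
    {y : GadNode (ofRel S hS)}
    (h : GadNode.type (G := ofRel R hR) mid' x = GadNode.type mid' y) :
    GadNode.type (G := ofRel R hR) mid x = GadNode.type mid y := by
  simp only [GadNode.type, Prod.mk.injEq] at h ⊢
  exact ⟨h.1, cls_eq_of_imp hm h.2.1, cls_eq_of_imp hm h.2.2⟩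

/-- This is where having two variables matters: once `i` is overwritten, the new node stands in
relation only to the node at `j`, and `typeOver` records all of that relation. -/
theorem Pebbled.update (h : Pebbled mid' s t) (hm : ∀ p, mid' p → mid p) {i j : Fin 2}
    (hij : j ≠ i) {a : GadNode (ofRel R hR)} {b : GadNode (ofRel S hS)}
    (hab : GadNode.typeOver (G := ofRel R hR) mid (s j) a = GadNode.typeOver mid (t j) b) :
    Pebbled mid (Function.update s i a) (Function.update t i b) := by
  simp only [GadNode.typeOver, Prod.mk.injEq, eq_iff_iff] at hab
  obtain ⟨htype, heq, hadj⟩ := hab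
  have htype' := type_eq_of_imp hm (h.type_eq j)
  have hall : ∀ k, k = i ∨ k = j := by omega
  have hsa : ¬ a.Adj a := (gad (ofRel R hR)).loopless a
  have htb : ¬ b.Adj b := (gad (ofRel S hS)).loopless b
  have hsc : ∀ {G : LabelledGraph 0} (u v : GadNode G), u.Adj v ↔ v.Adj u :=
    fun u v => ⟨GadNode.Adj.symm, GadNode.Adj.symm⟩
  refine ⟨fun k => ?_, fun k l => ?_, fun k l => ?_⟩
  · rcases hall k with rfl | rfl
    · simpa using htype
    · simpa [hij] using htype'
  · rcases hall k with rfl | rfl <;> rcases hall l with rfl | rfl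
    · simp
    · simpa [hij] using heq
    · simpa [hij, eq_comm] using heq
    · simp
  · rcases hall k with rfl | rfl <;> rcases hall l with rfl | rfl
    · simp [hsa, htb]
    · simpa [hij, hsc _ (s _), hsc _ (t _)] using hadj
    · simpa [hij] using hadj
    · simpa [hij] using h.adj_iff _ _

theorem Answerable.le_encard (H : Answerable K R S mid mid') (h : Pebbled mid' s t) {i j : Fin 2}
    (hij : j ≠ i) {A : Set (GadNode (ofRel R hR))} {B : Set (GadNode (ofRel S hS))}
    (hAB : ∀ a b, Pebbled mid (Function.update s i a) (Function.update t i b) → a ∈ A → b ∈ B)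
    {k : ℕ} (hk : k ≤ K) (hA : (k : ℕ∞) ≤ A.encard) : (k : ℕ∞) ≤ B.encard := by
  have := GadNode.finite (ofRel R hR)
  exact Set.natCast_le_encard_of_fibers (GadNode.typeOver (G := ofRel R hR) mid (s j))
    (GadNode.typeOver (G := ofRel S hS) mid (t j)) K
    (fun a₀ => H.answered (h.type_eq j).symm a₀)
    (fun a b hab ha => hAB a b (h.update H.mid_of_mid' hij hab) ha) hk hA

/-- Equivalent assignments satisfy the same formulas of bounded rank and bounded counts. -/
theorem realize_iff_of_pebbled {mid : ℕ → V → Prop} {q : ℕ}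
    (H : ∀ r < q, Answerable K R S (mid r) (mid (r + 1)))
    (H' : ∀ r < q, Answerable K S R (mid r) (mid (r + 1))) (φ : C2Formula 3)
    (hK : φ.countBound ≤ K) :
    ∀ r ≤ q, φ.rank ≤ r → ∀ (s : Fin 2 → GadNode (ofRel R hR)) (t : Fin 2 → GadNode (ofRel S hS)),
      Pebbled (mid r) s t →
      (φ.Realize (gad (ofRel R hR)) s ↔ φ.Realize (gad (ofRel S hS)) t) := by
  induction φ with
  | eq i j => exact fun r _ _ s t h => h.eq_iff i j
  | edge i j => exact fun r _ _ s t h => h.adj_iff i j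
  | pred p i =>
    intro r _ _ s t h
    have := gad_label_eq_of_kind_eq (congrArg Prod.fst (h.type_eq i))
    simp only [C2Formula.Realize]
    rw [this]
  | neg φ ih => exact fun r hr hφ s t h => not_congr (ih hK r hr hφ s t h)
  | conj φ ψ ih₁ ih₂ =>
    exact fun r hr hφ s t h =>
      and_congr (ih₁ ((le_max_left _ _).trans hK) r hr ((le_max_left _ _).trans hφ) s t h)
        (ih₂ ((le_max_right _ _).trans hK) r hr ((le_max_right _ _).trans hφ) s t h)
  | existsGE k i φ ih =>
    intro r hr hφ s t h
    obtain ⟨r, rfl⟩ : ∃ r', r = r' + 1 := ⟨r - 1, by simp only [C2Formula.rank] at hφ; omega⟩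
    have hφ' : φ.rank ≤ r := by simpa [C2Formula.rank] using hφ
    have hk : k ≤ K := (le_max_left _ _).trans hK
    have ih' := ih ((le_max_right _ _).trans hK) r (by omega) hφ'
    -- `1 - i` is the variable that keeps its value. The two directions of the equivalence play the
    -- round from `R` to `S` and from `S` to `R`.
    have hij : (1 - i : Fin 2) ≠ i := by omega
    exact ⟨(H r (by omega)).le_encard h hij (fun a b hab => (ih' _ _ hab).1) hk,
      (H' r (by omega)).le_encard h.symm hij (fun a b hab => (ih' _ _ hab.symm).2) hk⟩

end Pebbles

/-! ### The linear order and the linear order with a gap -/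

/-- `R` is the order of `Fin (2 * m + 2)`, except that the middle pair `(m, m + 1)` may be
missing. -/
structure AlmostLT {m : ℕ} (R : Fin (2 * m + 2) → Fin (2 * m + 2) → Prop) : Prop where
  lt : ∀ i j, R i j → i.val < j.val
  of_lt : ∀ i j, i.val < j.val → ¬ (i.val = m ∧ j.val = m + 1) → R i j

/-- The elements of `Fin (2 * m + 2)` at distance at least `c` from both ends. -/
def Central {m : ℕ} (c : ℕ) (p : Fin (2 * m + 2)) : Prop :=
  c ≤ p.val ∧ p.val + c < 2 * m + 2

theorem natCast_le_encard_of_injOn {V : Type*} {K : ℕ} {Q : Set V} (f : Fin K → V)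
    (hf : Function.Injective f) (hQ : ∀ i, f i ∈ Q) : (K : ℕ∞) ≤ Q.encard := by
  calc (K : ℕ∞) = (Set.range f).encard := by
        rw [← Set.image_univ, hf.encard_image]; simp
    _ ≤ Q.encard := Set.encard_le_encard (Set.range_subset_iff.2 hQ)

/-- A point outside either central set is neither `m` nor `m + 1`, so its pairs are unaffected by
the gap; a point outside the larger set is on the same side of all points inside it. Shrinking by `K
+ 2` leaves room for `K` further central points on both sides of each point of the smaller set. -/
theorem AlmostLT.answerable {m K c : ℕ} {R S : Fin (2 * m + 2) → Fin (2 * m + 2) → Prop}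
    (hR : AlmostLT R) (hS : AlmostLT S) (hc : c + (K + 2) ≤ m) :
    Answerable K R S (Central c) (Central (c + (K + 2))) where
  mid_of_mid' p hp := by unfold Central at *; omega
  exists_mid'_ne p₀ := by
    by_cases h : p₀.val = m
    · exact ⟨⟨m + 1, by omega⟩, by unfold Central; simp only; omega, by simp [Fin.ext_iff]; omega⟩
    · exact ⟨⟨m, by omega⟩, by unfold Central; simp only; omega, by simp [Fin.ext_iff]; omega⟩
  many_mid_ne p₀ := by
    by_cases h : p₀.val ≤ m
    · refine natCast_le_encard_of_injOn (fun t => ⟨m + 1 + t, by omega⟩) ?_ ?_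
      · intro t t' h; simp at h; omega
      · intro t
        simp only [Central, Set.mem_ofPred_eq, ne_eq, Fin.ext_iff]
        omega
    · refine natCast_le_encard_of_injOn (fun t => ⟨m - t, by omega⟩) ?_ ?_
      · intro t t' h; simp at h; omega
      · intro t
        simp only [Central, Set.mem_ofPred_eq, ne_eq, Fin.ext_iff]
        omega
  many_mid_orient b p hp := by
    unfold Central at hp
    cases b
    -- The offset 2 skips the immediate successor, which may be the missing partner of `p`; likewise
    -- for the predecessor below.
    · refine natCast_le_encard_of_injOn (fun t => ⟨p + 2 + t, by omega⟩) ?_ ?_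
      · intro t t' h; simp at h; omega
      · intro t
        refine ⟨by simp only [Central]; omega, hS.of_lt _ _ ?_ ?_⟩ <;> simp only <;> omega
    · refine natCast_le_encard_of_injOn (fun t => ⟨p - 2 - t, by omega⟩) ?_ ?_
      · intro t t' h; simp at h; omega
      · intro t
        refine ⟨by simp only [Central]; omega, hS.of_lt _ _ ?_ ?_⟩ <;> simp only <;> omega
  orient_of_not_mid' b u w hu h := by
    unfold Central at hu
    cases b
    · have := hR.lt _ _ h
      exact hS.of_lt _ _ this (by omega)
    · have := hR.lt _ _ h
      exact hS.of_lt _ _ this (by omega)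
  orient_of_mid b i i' w hi hi' hw h := by
    unfold Central at *
    cases b
    · have := hR.lt _ _ h
      exact hS.of_lt _ _ (by omega) (by omega)
    · have := hR.lt _ _ h
      exact hS.of_lt _ _ (by omega) (by omega)

/-! ### Recovering comparability from a gadgetisation -/

/-- A kind-preserving homomorphism between gadgetisations carries edges of `L` to edges of `G`. -/
theorem edge_of_gad_iso {d d' : ℕ} {G : LabelledGraph d} {L : LabelledGraph d'}
    {g : GadNode L → GadNode G} (hg : ∀ a b, a.Adj b → (g a).Adj (g b))
    (hkind : ∀ a, (g a).kind = a.kind) {u w : L.V} (h : L.E u w) {p q : G.V}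
    (hp : g (.base u) = .base p) (hq : g (.base w) = .base q) : G.E p q := by
  have h1 := hg _ _ (.inl (.first u w h))
  have h2 := hg _ _ (.inl (.middle u w h))
  have h3 := hg _ _ (.inl (.last u w h))
  have k2 := hkind (.second u w h)
  have k3 := hkind (.third u w h)
  rw [hp] at h1
  rw [hq] at h3
  -- The kinds force the image path to run base, second, third, base, and adjacency then makes it
  -- the path of one edge, from `p` to `q`.
  generalize g (.second u w h) = x at *
  generalize g (.third u w h) = y at *
  cases x with
  | base _ => simp [GadNode.kind] at k2
  | third _ _ _ => simp [GadNode.kind] at k2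
  | second a b hab =>
    cases y with
    | base _ => simp [GadNode.kind] at k3
    | second _ _ _ => simp [GadNode.kind] at k3
    | third a' b' hab' =>
      rcases h1 with h1 | h1 <;> cases h1
      rcases h2 with h2 | h2 <;> cases h2
      rcases h3 with h3 | h3 <;> cases h3
      exact hab

theorem kind_eq_of_gad_label_eq {d d' : ℕ} {G : LabelledGraph d} {H : LabelledGraph d'}
    {a : GadNode G} {b : GadNode H} (h : G.gad.label a = H.gad.label b) : a.kind = b.kind := by
  have h0 := congrFun h 0
  have h1 := congrFun h 1
  have h2 := congrFun h 2
  cases a <;> cases b <;> first | rfl | simp [gad] at h0 h1 h2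

/-- If the gadgetisation of `G` is isomorphic to that of a strict linear order, then any two
nodes of `G` are comparable. -/
theorem trichotomous_of_gadLin {d : ℕ} {G : LabelledGraph d} {v : G.gad.V}
    (h : gadLin G.gad v) (p q : G.V) (hpq : p ≠ q) : G.E p q ∨ G.E q p := by
  obtain ⟨d', L, hL, f, hE, hlabel⟩ := h
  have hkind : ∀ a : GadNode G, GadNode.kind (G := L) (f a) = a.kind :=
    fun a => kind_eq_of_gad_label_eq (hlabel a)
  let g : GadNode L → GadNode G := f.symm
  have hgkind : ∀ a, (g a).kind = a.kind := fun a => by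
    rw [← hkind (g a)]
    exact congrArg GadNode.kind (f.apply_symm_apply a)
  have hg : ∀ a b, a.Adj b → (g a).Adj (g b) := fun a b hab => by
    have hE' : ∀ x y : L.gad.V, L.gad.E x y → G.gad.E (f.symm x) (f.symm y) := fun x y h => by
      rwa [hE, f.apply_symm_apply, f.apply_symm_apply]
    exact hE' a b hab
  have hbase : ∀ p : G.V, ∃ u : L.V, g (.base u) = .base p := by
    intro p
    rcases GadNode.eq_base_or_arc (G := L) (f (.base p)) with ⟨u, hu⟩ | ⟨b, x, y, hxy, hu⟩
    · exact ⟨u, by rw [← hu]; exact f.symm_apply_apply _⟩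
    · have := hkind (.base p)
      rw [hu] at this
      simp at this
  obtain ⟨u, hu⟩ := hbase p
  obtain ⟨w, hw⟩ := hbase q
  have hL' : IsStrictTotalOrder L.V L.E := hL
  rcases trichotomous_of L.E u w with h | rfl | h
  · exact .inl (edge_of_gad_iso hg hgkind h hu hw)
  · rw [hu] at hw
    cases hw
    exact absurd rfl hpq
  · exact .inr (edge_of_gad_iso hg hgkind h hw hu)

end LabelledGraph

/-! ### The contradiction -/

open LabelledGraph in
theorem mainTheorem8 : ¬ gadLin.ExpressibleInC2OverUndirected := by
  rintro ⟨φ, -, hφ⟩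
  set K := φ.countBound
  set q := φ.rank
  -- Just large enough that after `q` shrinkings by `K + 2` the central set still contains `m` and
  -- `m + 1`.
  obtain ⟨m, hm⟩ : ∃ m, m = q * (K + 2) := ⟨_, rfl⟩
  let R : Fin (2 * m + 2) → Fin (2 * m + 2) → Prop := fun i j => i.val < j.val
  let S : Fin (2 * m + 2) → Fin (2 * m + 2) → Prop :=
    fun i j => i.val < j.val ∧ ¬ (i.val = m ∧ j.val = m + 1)
  have hR : AlmostLT R := ⟨fun _ _ h => h, fun _ _ h _ => h⟩
  have hS : AlmostLT S := ⟨fun _ _ h => h.1, fun _ _ h h' => ⟨h, h'⟩⟩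
  have hR₀ : ∀ v, ¬ R v v := fun v => lt_irrefl _
  have hS₀ : ∀ v, ¬ S v v := fun v h => lt_irrefl _ h.1
  have hlevel : ∀ r < q, r * (K + 2) + (K + 2) ≤ m := fun r hr => by
    rw [← Nat.succ_mul, hm]
    exact Nat.mul_le_mul_right _ hr
  have hstep : ∀ {R S : Fin (2 * m + 2) → Fin (2 * m + 2) → Prop}, AlmostLT R → AlmostLT S →
      ∀ r < q, Answerable K R S (Central (r * (K + 2))) (Central ((r + 1) * (K + 2))) := by
    intro R S hR hS r hr
    rw [Nat.succ_mul r]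
    exact hR.answerable hS (hlevel r hr)
  let p : Fin (2 * m + 2) := ⟨m, by omega⟩
  let p' : Fin (2 * m + 2) := ⟨m + 1, by omega⟩
  have hiff : φ.Sat (gad (ofRel R hR₀)) (.base p) ↔ φ.Sat (gad (ofRel S hS₀)) (.base p) := by
    -- Both pebbles start on the base node of the same point in either graph, so the positions match
    -- at level `q`.
    refine realize_iff_of_pebbled (mid := fun r => Central (r * (K + 2))) (hstep hR hS)
      (hstep hS hR) φ le_rfl q le_rfl le_rfl _ _ ⟨fun _ => rfl, fun _ _ => by simp, fun _ _ => ?_⟩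
    exact iff_of_false ((gad (ofRel R hR₀)).loopless _) ((gad (ofRel S hS₀)).loopless _)
  have hlin : gadLin (gad (ofRel R hR₀)) (.base p) := by
    refine ⟨0, ofRel R hR₀, ?_, Equiv.refl _, fun _ _ => Iff.rfl, fun _ => rfl⟩
    exact inferInstanceAs (IsStrictTotalOrder (Fin (2 * m + 2)) (· < ·))
  have hgap := (hφ _ (gad_isUndirected _) _).1
    (hiff.1 ((hφ _ (gad_isUndirected _) _).2 hlin))
  rcases trichotomous_of_gadLin hgap p p' (by simp [p, p', Fin.ext_iff]) with h | h
  · exact h.2 ⟨rfl, rfl⟩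
  · have : m + 1 < m := h.1
    omega
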